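/- Let $X=\{X(t),t\in T\}$ be a real-valued max-infinitely divisible process, i.e. for every $n\ge 1$ it has the same finite-dimensional distributions as the pointwise maximum of some $n$ i.i.d. processes, and assume $\operatorname{ess\,inf}X(t)=0$ for every $t\in T$. For a $\sigma$-finite measure space $(\Omega,\mathcal B,\mu)$ let $\mathcal L^\vee(\Omega,\mathcal B,\mu)$ be the set of measurable $f:\Omega\to\mathbb R$ with $f\ge 0$ $\mu$-a.e. and $\mu\{f>a\}<\infty$ for all $a>0$. A family $\{f_t,t\in T\}\subset\mathcal L^\vee(\Omega,\mathcal B,\mu)$ is a spectral representation of $X$ if $X$ has the same finite-dimensional distributions as $\{\sup_{i\in J}f_t(U_i),\,t\in T\}$, where $\{U_i,i\in J\}$ is a Poisson point process on $(\Omega,\mathcal B)$ with intensity $\mu$ ($J$ at most countable, possibly random) and the supremum is $0$ if there are no points. It is minimal if (a) for every $B\in\mathcal B$ there is $A\in\sigma\{f_t,t\in T\}$ with $\mu(A\triangle B)=0$, and (b) there is no $B\in\mathcal B$ with $\mu(B)>0$ such that for every $t\in T$, $f_t=0$ $\mu$-a.e. on $B$. A $\sigma$-finite Borel space is a measurable space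 isomorphic to a complete separable metric space with its Borel $\sigma$-algebra, endowed with a $\sigma$-finite measure. Let $\{f^{(i)}_t,t\in T\}$, $i=1,2$, be two minimal spectral representations of $X$, defined on $\sigma$-finite measure spaces $(\Omega_i,\mathcal B_i,\mu_i)$, with $\Omega_1\ne\emptyset$. (i) If $(\Omega_1,\mathcal B_1,\mu_1)$ is a $\sigma$-finite Borel space, then there is a measurable map $\Phi:\Omega_2\to\Omega_1$ such that $\mu_1=\mu_2\circ\Phi^{-1}$ and, for every $t\in T$, $f^{(2)}_t=f^{(1)}_t\circ\Phi$ $\mu_2$-a.e. (ii) If both $(\Omega_i,\mathcal B_i,\mu_i)$ are $\sigma$-finite Borel spaces, then every map $\Phi$ as in (i) is an isomorphism of measure spaces modulo null sets, i.e. there are null sets $A_2\in\mathcal B_2$ and $A_1\in\mathcal B_1$ such that $\Phi$ restricts to a measure-preserving bijection $\Omega_2\setminus A_2\to\Omega_1\setminus A_1$ that is measurable together with its inverse; and $\Phi$ is unique modulo null sets: any two maps as in (i) agree $\mu_2$-a.e. -/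

import Mathlib

open MeasureTheory ProbabilityTheory

universe u v w

/-- Equality of all finite-dimensional distributions of two real-valued processes, possibly
defined on different probability spaces. -/
def SameFDD {T : Type*} {E S : Type*} [MeasurableSpace E] [MeasurableSpace S]
    (X : T → E → ℝ) (P : Measure E) (Y : T → S → ℝ) (Q : Measure S) : Prop :=
  ∀ I : Finset T, IdentDistrib (fun e (t : I) => X t e) (fun s (t : I) => Y t s) P Q

/-- A process is max-infinitely divisible if, for every `n ≥ 1`, it has the same
finite-dimensional distributions as the pointwise maximum of `n` independent identically
distributed processes. (The i.i.d. processes can always be realised on the canonical space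
`Fin n → T → ℝ`, so that letting `S` range over the universe of `T` is no restriction.) -/
def IsMaxID {T : Type u} {E : Type*} [MeasurableSpace E] (X : T → E → ℝ) (P : Measure E) : Prop :=
  ∀ n : ℕ, 1 ≤ n →
    ∃ (S : Type u) (_ : MeasurableSpace S) (Q : Measure S) (Y : Fin n → T → S → ℝ),
      IsProbabilityMeasure Q ∧ (∀ i t, Measurable (Y i t)) ∧
      iIndepFun (fun i s (t : T) => Y i t s) Q ∧
      (∀ i j, IdentDistrib (fun s (t : T) => Y i t s) (fun s (t : T) => Y j t s) Q Q) ∧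
      SameFDD X P (fun t s => ⨆ i, Y i t s) Q

/-- The number of points, counted with multiplicity, of the configuration `U · s` that lie in `A`.
A random at most countable family of points of `Ω` is encoded as a sequence
`U : ℕ → S → Option Ω`, where `U n s = none` means that the `n`-th point is absent. -/
noncomputable def pointCount {Ω S : Type*} (U : ℕ → S → Option Ω) (A : Set Ω) (s : S) : ℕ∞ :=
  {n : ℕ | ∃ ω ∈ A, U n s = some ω}.encard

/-- The random at most countable family of points `U`, defined on the probability space `(S, Q)`,
is a Poisson point process on `Ω` with intensity measure `μ`. -/
structure IsPoissonPointProcess {Ω S : Type*} [MeasurableSpace Ω] [MeasurableSpace S]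
    (U : ℕ → S → Option Ω) (Q : Measure S) (μ : Measure Ω) : Prop where
  /-- each point is a random element of `Ω`, defined on a measurable event -/
  measurable : ∀ (n : ℕ) (A : Set Ω), MeasurableSet A →
    MeasurableSet {s | ∃ ω ∈ A, U n s = some ω}
  /-- the number of points in a set of finite measure is Poisson distributed -/
  poisson : ∀ A : Set Ω, MeasurableSet A → μ A ≠ ⊤ →
    HasLaw (pointCount U A) ((poissonMeasure (μ A).toNNReal).map (Nat.cast : ℕ → ℕ∞)) Q
  /-- a set of infinite measure contains infinitely many points -/
  infinite : ∀ A : Set Ω, MeasurableSet A → μ A = ⊤ → ∀ᵐ s ∂Q, pointCount U A s = ⊤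
  /-- the numbers of points in disjoint sets are independent -/
  indep : ∀ (k : ℕ) (A : Fin k → Set Ω), (∀ i, MeasurableSet (A i)) →
    Pairwise (Function.onFun Disjoint A) → iIndepFun (fun i => pointCount U (A i)) Q

/-- The stochastic max-integral: the supremum of `f` over the points of the process, and `0` if
there are no points (`sSup ∅ = 0` in `ℝ`). -/
noncomputable def maxIntegral {Ω S : Type*} (U : ℕ → S → Option Ω) (f : Ω → ℝ) (s : S) : ℝ :=
  sSup {x : ℝ | ∃ n ω, U n s = some ω ∧ f ω = x}

/-- The class of admissible integrands of the max-integral. -/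
structure MemLMax {Ω : Type*} [MeasurableSpace Ω] (f : Ω → ℝ) (μ : Measure Ω) : Prop where
  measurable : Measurable f
  nonneg : ∀ᵐ ω ∂μ, 0 ≤ f ω
  finite : ∀ a : ℝ, 0 < a → μ {ω | a < f ω} < ⊤

/-- `f` is a spectral representation of the process `X` over `(Ω, μ)`: the process has the same
finite-dimensional distributions as the max-integrals of the `f t` with respect to a Poisson point
process with intensity `μ`. (A Poisson point process with `σ`-finite intensity exists on
some probability space in the universe of `Ω`, and the finite-dimensional distributions of the
max-integrals do not depend on its choice.) -/
def IsSpectralRepresentation {T E : Type*} {Ω : Type w} [MeasurableSpace E] [MeasurableSpace Ω]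
    (X : T → E → ℝ) (P : Measure E) (f : T → Ω → ℝ) (μ : Measure Ω) : Prop :=
  (∀ t, MemLMax (f t) μ) ∧
    ∃ (S : Type w) (_ : MeasurableSpace S) (Q : Measure S) (U : ℕ → S → Option Ω),
      IsProbabilityMeasure Q ∧ IsPoissonPointProcess U Q μ ∧
      SameFDD X P (fun t => maxIntegral U (f t)) Q

/-- Minimality of a family of functions: it generates the `σ`-algebra up to null sets and has full
support. -/
structure IsMinimalFamily {T Ω : Type*} [MeasurableSpace Ω] (f : T → Ω → ℝ) (μ : Measure Ω) :
    Prop where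
  generates : ∀ B : Set Ω, MeasurableSet B →
    ∃ A : Set Ω, MeasurableSet[⨆ t, MeasurableSpace.comap (f t) inferInstance] A ∧
      μ (symmDiff A B) = 0
  fullSupport : ¬ ∃ B : Set Ω, MeasurableSet B ∧ 0 < μ B ∧ ∀ t, ∀ᵐ ω ∂μ.restrict B, f t ω = 0

/-- A minimal spectral representation of `X`. -/
def IsMinimalSpectralRepresentation {T E : Type*} {Ω : Type w} [MeasurableSpace E]
    [MeasurableSpace Ω] (X : T → E → ℝ) (P : Measure E) (f : T → Ω → ℝ) (μ : Measure Ω) : Prop :=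
  IsSpectralRepresentation X P f μ ∧ IsMinimalFamily f μ

/-- `Φ : Ω → Ω'` is an isomorphism modulo null sets of the measure spaces `(Ω, μ)` and `(Ω', μ')`:
off measurable null sets `A` and `A'` it is a bijection `Aᶜ → A'ᶜ`, measurable in both
directions, that preserves the measure. -/
def IsMeasureSpaceIso {Ω Ω' : Type*} [MeasurableSpace Ω] [MeasurableSpace Ω'] (Φ : Ω → Ω')
    (μ : Measure Ω) (μ' : Measure Ω') : Prop :=
  ∃ (A : Set Ω) (A' : Set Ω'), MeasurableSet A ∧ MeasurableSet A' ∧ μ A = 0 ∧ μ' A' = 0 ∧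
    ∃ e : (Aᶜ : Set Ω) ≃ᵐ (A'ᶜ : Set Ω'), (∀ ω : (Aᶜ : Set Ω), (e ω : Ω') = Φ ω) ∧
      ∀ B : Set Ω, MeasurableSet B → B ⊆ Aᶜ → μ B = μ' (Φ '' B)

/-- A finite set of values `x > b`, all smaller than `a > b ≥ 0`, controls the supremum. -/
theorem Real.sSup_lt_iff_of_finite_inter_Ioi {V : Set ℝ} {a b : ℝ} (hb : 0 ≤ b) (hba : b < a)
    (hV : (V ∩ Set.Ioi b).Finite) : sSup V < a ↔ ∀ x ∈ V, x < a := by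
  obtain ⟨M, hM⟩ := hV.bddAbove
  have hbdd : BddAbove V := ⟨max M b, fun x hx => by
    by_cases h : b < x
    · exact le_max_of_le_left (hM ⟨hx, h⟩)
    · exact le_max_of_le_right (not_lt.1 h)⟩
  refine ⟨fun h x hx => (le_csSup hbdd hx).trans_lt h, fun h => ?_⟩
  obtain ⟨m, hm, hmax⟩ := (hV.insert b).exists_maximalFor id _ (Set.insert_nonempty _ _)
  have hmax' : ∀ y ∈ insert b (V ∩ Set.Ioi b), y ≤ m := fun y hy => by
    by_contra hlt
    exact hlt (hmax hy (not_le.1 hlt).le)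
  have hma : m < a := by
    rcases hm with rfl | hm
    · exact hba
    · exact h m hm.1
  refine lt_of_le_of_lt (Real.sSup_le (fun x hx => ?_) ?_) hma
  · by_cases hx' : b < x
    · exact hmax' x (Or.inr ⟨hx, hx'⟩)
    · exact (not_lt.1 hx').trans (hmax' b (Or.inl rfl))
  · exact hb.trans (hmax' b (Or.inl rfl))

namespace IsPoissonPointProcess

variable {Ω S : Type*} [MeasurableSpace Ω] [MeasurableSpace S] {U : ℕ → S → Option Ω}
  {Q : Measure S} {μ : Measure Ω}

theorem ae_pointCount_ne_top (hU : IsPoissonPointProcess U Q μ) {A : Set Ω}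
    (hA : MeasurableSet A) (hμ : μ A ≠ ⊤) : ∀ᵐ s ∂Q, pointCount U A s ≠ ⊤ := by
  have h := (hU.poisson A hA hμ).measure_eq (p := fun n => n = ⊤) .of_discrete
  rw [ae_iff]
  simp only [ne_eq, not_not]
  have htop : (Nat.cast : ℕ → ℕ∞) ⁻¹' {x | x = ⊤} = ∅ := by ext; simp
  rw [h, Measure.map_apply .of_discrete .of_discrete, htop, measure_empty]

theorem measure_pointCount_eq_zero (hU : IsPoissonPointProcess U Q μ) {A : Set Ω}
    (hA : MeasurableSet A) (hμ : μ A ≠ ⊤) :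
    Q {s | pointCount U A s = 0} = ENNReal.ofReal (Real.exp (-(μ A).toReal)) := by
  rw [(hU.poisson A hA hμ).measure_eq (p := fun n => n = 0) .of_discrete,
    Measure.map_apply .of_discrete .of_discrete]
  have : (Nat.cast : ℕ → ℕ∞) ⁻¹' {x | x = 0} = {0} := by ext; simp
  rw [this, poissonMeasure_singleton]
  simp [ENNReal.coe_toNNReal_eq_toReal]

/-- Almost surely, a max-integral lies below a positive level exactly when no point of the process
reaches this level. -/
theorem ae_maxIntegral_lt_iff (hU : IsPoissonPointProcess U Q μ) {f : Ω → ℝ} (hf : MemLMax f μ)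
    {a : ℝ} (ha : 0 < a) :
    ∀ᵐ s ∂Q, maxIntegral U f s < a ↔ ∀ n ω, U n s = some ω → f ω < a := by
  have hmeas : MeasurableSet {ω | a / 2 < f ω} := measurableSet_lt measurable_const hf.measurable
  filter_upwards [hU.ae_pointCount_ne_top hmeas (hf.finite _ (half_pos ha)).ne] with s hs
  have hfin : {n : ℕ | ∃ ω ∈ {ω | a / 2 < f ω}, U n s = some ω}.Finite :=
    Set.encard_ne_top_iff.1 hs
  have hV : ({x : ℝ | ∃ n ω, U n s = some ω ∧ f ω = x} ∩ Set.Ioi (a / 2)).Finite := by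
    refine (hfin.image fun n => ((U n s).map f).getD 0).subset ?_
    rintro _ ⟨⟨n, ω, hn, rfl⟩, hx⟩
    exact ⟨n, ⟨ω, hx, hn⟩, by simp [hn]⟩
  rw [maxIntegral, Real.sSup_lt_iff_of_finite_inter_Ioi (half_pos ha).le (half_lt_self ha) hV]
  exact ⟨fun h n ω hn => h _ ⟨n, ω, hn, rfl⟩, fun h x ⟨n, ω, hn, hx⟩ => hx ▸ h n ω hn⟩

end IsPoissonPointProcess

theorem MemLMax.measure_le_lt_top {Ω : Type*} [MeasurableSpace Ω] {f : Ω → ℝ} {μ : Measure Ω}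
    (hf : MemLMax f μ) {a : ℝ} (ha : 0 < a) : μ {ω | a ≤ f ω} < ⊤ :=
  (measure_mono fun _ h => (half_lt_self ha).trans_le h).trans_lt (hf.finite _ (half_pos ha))

section FiniteDimensional

variable {T E : Type*} [MeasurableSpace E] {X : T → E → ℝ} {P : Measure E}

/-- The points of `Ω` at which the level `k.2` is reached by `f k.1`, for some `k ∈ K`. -/
def exceedance {Ω : Type*} (f : T → Ω → ℝ) (K : Finset (T × ℝ)) : Set Ω :=
  ⋃ k ∈ K, {ω | k.2 ≤ f k.1 ω}

theorem measurableSet_exceedance {Ω : Type*} [MeasurableSpace Ω] {f : T → Ω → ℝ}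
    (hf : ∀ t, Measurable (f t)) (K : Finset (T × ℝ)) : MeasurableSet (exceedance f K) :=
  K.measurableSet_biUnion fun k _ => measurableSet_le measurable_const (hf k.1)

theorem measure_exceedance_ne_top {Ω : Type*} [MeasurableSpace Ω] {f : T → Ω → ℝ}
    {μ : Measure Ω} (hf : ∀ t, MemLMax (f t) μ) {K : Finset (T × ℝ)}
    (hK : ∀ k ∈ K, 0 < k.2) : μ (exceedance f K) ≠ ⊤ :=
  (measure_biUnion_lt_top K.finite_toSet fun {k} hk =>
    (hf k.1).measure_le_lt_top (hK k hk)).ne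

/-- The finite-dimensional distributions of a process in terms of a spectral representation. -/
theorem IsSpectralRepresentation.measure_forall_lt {Ω : Type w} [MeasurableSpace Ω]
    {f : T → Ω → ℝ} {μ : Measure Ω} (h : IsSpectralRepresentation X P f μ)
    {K : Finset (T × ℝ)} (hK : ∀ k ∈ K, 0 < k.2) :
    P {e | ∀ k ∈ K, X k.1 e < k.2} =
      ENNReal.ofReal (Real.exp (-(μ (exceedance f K)).toReal)) := by
  classical
  obtain ⟨hf, S, _, Q, U, _, hU, hfdd⟩ := h
  have hC : MeasurableSet {x : K.image Prod.fst → ℝ |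
      ∀ k (hk : k ∈ K), x ⟨k.1, Finset.mem_image_of_mem _ hk⟩ < k.2} := by
    have : {x : K.image Prod.fst → ℝ |
        ∀ k (hk : k ∈ K), x ⟨k.1, Finset.mem_image_of_mem _ hk⟩ < k.2} =
        ⋂ k : K, {x | x ⟨k.1.1, Finset.mem_image_of_mem _ k.2⟩ < k.1.2} := by
      ext
      simp
    rw [this]
    exact MeasurableSet.iInter fun k => measurableSet_lt (measurable_pi_apply _) measurable_const
  have hPQ := (hfdd (K.image Prod.fst)).measure_mem_eq hC
  simp only [Set.preimage_ofPred_eq] at hPQ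
  rw [hPQ, ← hU.measure_pointCount_eq_zero (measurableSet_exceedance (fun t => (hf t).measurable) K)
    (measure_exceedance_ne_top hf hK)]
  refine measure_congr ?_
  have hae : ∀ᵐ s ∂Q, ∀ k ∈ K,
      (maxIntegral U (f k.1) s < k.2 ↔ ∀ n ω, U n s = some ω → f k.1 ω < k.2) :=
    (ae_ball_iff K.countable_toSet).2 fun k hk => hU.ae_maxIntegral_lt_iff (hf k.1) (hK k hk)
  refine Filter.eventuallyEq_set.2 ?_
  filter_upwards [hae] with s hs
  simp only [pointCount, Set.encard_eq_zero, exceedance]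
  constructor
  · intro h
    refine Set.eq_empty_of_forall_notMem ?_
    rintro n ⟨ω, hω, hn⟩
    simp only [Set.mem_iUnion, Set.mem_ofPred_eq, exists_prop] at hω
    obtain ⟨k, hk, hle⟩ := hω
    exact absurd ((hs k hk).1 (h k hk) n ω hn) (not_lt.2 hle)
  · intro h k hk
    refine (hs k hk).2 fun n ω hn => ?_
    by_contra hle
    have : n ∈ (∅ : Set ℕ) := h ▸ ⟨ω, Set.mem_biUnion hk (not_lt.1 hle), hn⟩
    exact this

/-- Any two spectral representations of a process have the same exponent measure on finite unions
of half spaces. -/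
theorem IsSpectralRepresentation.measure_exceedance_eq {Ω₁ : Type v} {Ω₂ : Type w}
    [MeasurableSpace Ω₁] [MeasurableSpace Ω₂] {f₁ : T → Ω₁ → ℝ} {f₂ : T → Ω₂ → ℝ}
    {μ₁ : Measure Ω₁} {μ₂ : Measure Ω₂} (h₁ : IsSpectralRepresentation X P f₁ μ₁)
    (h₂ : IsSpectralRepresentation X P f₂ μ₂) {K : Finset (T × ℝ)} (hK : ∀ k ∈ K, 0 < k.2) :
    μ₁ (exceedance f₁ K) = μ₂ (exceedance f₂ K) := by
  have h := (h₁.measure_forall_lt hK).symm.trans (h₂.measure_forall_lt hK)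
  rw [ENNReal.ofReal_eq_ofReal_iff (Real.exp_pos _).le (Real.exp_pos _).le, Real.exp_eq_exp,
    neg_inj, ENNReal.toReal_eq_toReal_iff' (measure_exceedance_ne_top h₁.1 hK)
      (measure_exceedance_ne_top h₂.1 hK)] at h
  exact h

end FiniteDimensional

section Coordinates

variable {T : Type*}

/-- The sets `{x | x t < b}` cut out by finitely many pairs `(t, b)`. -/
def lowerBox (K : Finset (T × ℝ)) : Set (T → ℝ) := {x | ∀ k ∈ K, x k.1 < k.2}

theorem measurableSet_lowerBox (K : Finset (T × ℝ)) : MeasurableSet (lowerBox K) := by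
  have : lowerBox K = ⋂ k ∈ K, {x | x k.1 < k.2} := by ext; simp [lowerBox]
  rw [this]
  exact K.measurableSet_biInter fun k _ =>
    measurableSet_lt (measurable_pi_apply _) measurable_const

theorem isPiSystem_range_lowerBox : IsPiSystem (Set.range (lowerBox (T := T))) := by
  classical
  rintro _ ⟨K, rfl⟩ _ ⟨L, rfl⟩ -
  refine ⟨K ∪ L, ?_⟩
  ext x
  simp only [lowerBox, Finset.mem_union, Set.mem_inter_iff, Set.mem_ofPred_eq]
  exact ⟨fun h => ⟨fun k hk => h k (Or.inl hk), fun k hk => h k (Or.inr hk)⟩,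
    fun h k hk => hk.elim (h.1 k) (h.2 k)⟩

theorem pi_eq_generateFrom_range_lowerBox :
    (MeasurableSpace.pi : MeasurableSpace (T → ℝ)) =
      MeasurableSpace.generateFrom (Set.range lowerBox) := by
  refine le_antisymm (iSup_le fun t => ?_) (MeasurableSpace.generateFrom_le ?_)
  · rw [← measurable_iff_comap_le]
    refine measurable_of_Iio (mδ := MeasurableSpace.generateFrom _) fun b => ?_
    refine MeasurableSpace.measurableSet_generateFrom ⟨{(t, b)}, ?_⟩
    ext x
    simp [lowerBox]
  · rintro _ ⟨K, rfl⟩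
    exact measurableSet_lowerBox K

/-- Preimages of measurable sets of the product space under two families that agree almost
everywhere coordinatewise agree almost everywhere, for arbitrary index sets. -/
theorem ae_mem_iff_of_forall_ae_eq {Ω : Type*} [MeasurableSpace Ω] {μ : Measure Ω}
    {F G : Ω → T → ℝ} (h : ∀ t, ∀ᵐ ω ∂μ, F ω t = G ω t) {C : Set (T → ℝ)}
    (hC : MeasurableSet C) : ∀ᵐ ω ∂μ, F ω ∈ C ↔ G ω ∈ C := by
  rw [pi_eq_generateFrom_range_lowerBox] at hC
  induction C, hC using MeasurableSpace.generateFrom_induction with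
  | hC C hC _ =>
    obtain ⟨K, rfl⟩ := hC
    have : ∀ᵐ ω ∂μ, ∀ k ∈ K, F ω k.1 = G ω k.1 :=
      (ae_ball_iff K.countable_toSet).2 fun k _ => h k.1
    filter_upwards [this] with ω hω
    exact forall₂_congr fun k hk => by rw [hω k hk]
  | empty => simp
  | compl C _ ih => filter_upwards [ih] with ω hω using not_congr hω
  | iUnion C _ ih =>
    filter_upwards [ae_all_iff.2 ih] with ω hω
    simp only [Set.mem_iUnion, hω]

theorem exists_preimage_of_measurableSet_iSup_comap {Ω : Type*} {f : T → Ω → ℝ} {A : Set Ω}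
    (hA : MeasurableSet[⨆ t, MeasurableSpace.comap (f t) inferInstance] A) :
    ∃ C : Set (T → ℝ), MeasurableSet C ∧ (fun ω t => f t ω) ⁻¹' C = A := by
  have : (⨆ t, MeasurableSpace.comap (f t) inferInstance) =
      MeasurableSpace.comap (fun ω t => f t ω) MeasurableSpace.pi := by
    simp only [MeasurableSpace.pi, MeasurableSpace.comap_iSup, MeasurableSpace.comap_comp]
    rfl
  rw [this] at hA
  exact hA

end Coordinates

section ExponentMeasure

variable {T : Type*} {Ω : Type*} [MeasurableSpace Ω] {f : T → Ω → ℝ} {μ : Measure Ω}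

/-- A family with full support contains a countable subfamily with full support. -/
theorem IsMinimalFamily.exists_countable_ae_pos [SigmaFinite μ] (hmem : ∀ t, MemLMax (f t) μ)
    (h : IsMinimalFamily f μ) :
    ∃ D : Set T, D.Countable ∧ ∀ᵐ ω ∂μ, ∃ t ∈ D, 0 < f t ω := by
  let supp : Set T → Set Ω := fun D => ⋃ t ∈ D, {ω | 0 < f t ω}
  have hpos : ∀ t, MeasurableSet {ω | 0 < f t ω} := fun t =>
    measurableSet_lt measurable_const (hmem t).measurable
  have hsupp : ∀ D : Set T, D.Countable → MeasurableSet (supp D) := fun D hD =>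
    MeasurableSet.biUnion hD fun t _ => hpos t
  have : Nonempty {D : Set T // D.Countable} := ⟨⟨∅, Set.countable_empty⟩⟩
  obtain ⟨u, -, hu, hmemu⟩ := exists_seq_tendsto_sSup
    (Set.range_nonempty fun D : {D : Set T // D.Countable} => μ.toFinite (supp D))
    (OrderTop.bddAbove _)
  choose D hD using hmemu
  have hcount : (⋃ n, (D n : Set T)).Countable := Set.countable_iUnion fun n => (D n).2
  have hmax : ∀ t, μ.toFinite (supp (insert t (⋃ n, (D n : Set T)))) ≤
      μ.toFinite (supp (⋃ n, (D n : Set T))) := fun t => by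
    refine (le_sSup (Set.mem_range_self (⟨_, hcount.insert t⟩ : {D : Set T // D.Countable}))).trans (le_of_tendsto' hu fun n => ?_)
    rw [← hD n]
    exact measure_mono (Set.biUnion_subset_biUnion_left (Set.subset_iUnion (fun n => (D n : Set T)) n))
  refine ⟨⋃ n, (D n : Set T), hcount, ?_⟩
  by_contra hne
  refine h.fullSupport ⟨(supp (⋃ n, (D n : Set T)))ᶜ, (hsupp _ hcount).compl, ?_, fun t => ?_⟩
  · refine pos_iff_ne_zero.2 fun h0 => hne (measure_mono_null (fun ω hω => ?_) h0)
    simpa [supp] using hω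
  · rw [ae_restrict_iff' (hsupp _ hcount).compl]
    have hnull : μ (supp (insert t (⋃ n, (D n : Set T))) \ supp (⋃ n, (D n : Set T))) = 0 := by
      rw [← toFinite_apply_eq_zero_iff, measure_sdiff
        (Set.biUnion_subset_biUnion_left (Set.subset_insert _ _))
        (hsupp _ hcount).nullMeasurableSet (measure_ne_top _ _)]
      exact tsub_eq_zero_of_le (hmax t)
    filter_upwards [(hmem t).nonneg, measure_eq_zero_iff_ae_notMem.1 hnull] with ω h0 hω hωc
    refine le_antisymm (not_lt.1 fun hlt => hω ⟨?_, hωc⟩) h0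
    exact Set.mem_biUnion (Set.mem_insert t _) hlt

omit [MeasurableSpace Ω] in
theorem preimage_lowerBox_inter (K : Finset (T × ℝ)) (t : T) (a : ℝ) [DecidableEq (T × ℝ)] :
    (fun ω s => f s ω) ⁻¹' lowerBox K ∩ {ω | a ≤ f t ω} =
      exceedance f (insert (t, a) K) \ exceedance f K := by
  ext ω
  simp only [lowerBox, exceedance, Set.mem_inter_iff, Set.mem_preimage, Set.mem_ofPred_eq,
    Set.mem_sdiff, Set.mem_iUnion, Finset.mem_insert, exists_prop, not_exists, not_and, not_le]
  constructor
  · exact fun h => ⟨⟨_, Or.inl rfl, h.2⟩, h.1⟩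
  · rintro ⟨⟨k, rfl | hk, hle⟩, h⟩
    · exact ⟨h, hle⟩
    · exact absurd hle (not_le.2 (h k hk))

theorem measure_preimage_lowerBox_inter (hf : ∀ t, MemLMax (f t) μ) {K : Finset (T × ℝ)}
    (hK : ∀ k ∈ K, 0 < k.2) (t : T) (a : ℝ) [DecidableEq (T × ℝ)] :
    μ ((fun ω s => f s ω) ⁻¹' lowerBox K ∩ {ω | a ≤ f t ω}) =
      μ (exceedance f (insert (t, a) K)) - μ (exceedance f K) := by
  have hsub : exceedance f K ⊆ exceedance f (insert (t, a) K) :=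
    Set.biUnion_subset_biUnion_left (Finset.coe_subset.2 (Finset.subset_insert _ _))
  rw [preimage_lowerBox_inter, measure_sdiff hsub
    (measurableSet_exceedance (fun t => (hf t).measurable) K).nullMeasurableSet
    (measure_exceedance_ne_top hf hK)]

theorem measure_preimage_lowerBox_eq_zero (hf : ∀ t, MemLMax (f t) μ) {K : Finset (T × ℝ)}
    {k : T × ℝ} (hk : k ∈ K) (hk0 : k.2 ≤ 0) :
    μ ((fun ω s => f s ω) ⁻¹' lowerBox K) = 0 := by
  refine measure_mono_null (fun ω hω => ?_) (ae_iff.1 (hf k.1).nonneg)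
  exact not_le.2 ((hω k hk).trans_le hk0)

theorem measurable_coordinates (hf : ∀ t, MemLMax (f t) μ) : Measurable fun ω t => f t ω :=
  measurable_pi_iff.2 fun t => (hf t).measurable

end ExponentMeasure

section Isomorphism

variable {T E : Type*} [MeasurableSpace E] {X : T → E → ℝ} {P : Measure E}
  {Ω₁ : Type v} {Ω₂ : Type w} [MeasurableSpace Ω₁] [MeasurableSpace Ω₂]
  {f₁ : T → Ω₁ → ℝ} {f₂ : T → Ω₂ → ℝ} {μ₁ : Measure Ω₁} {μ₂ : Measure Ω₂}

theorem IsSpectralRepresentation.restrict_map_eq (h₁ : IsSpectralRepresentation X P f₁ μ₁)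
    (h₂ : IsSpectralRepresentation X P f₂ μ₂) (t : T) {a : ℝ} (ha : 0 < a) :
    (μ₁.map fun ω t => f₁ t ω).restrict {x | a ≤ x t} =
      (μ₂.map fun ω t => f₂ t ω).restrict {x | a ≤ x t} := by
  classical
  have hS : MeasurableSet {x : T → ℝ | a ≤ x t} :=
    measurableSet_le measurable_const (measurable_pi_apply t)
  have hbox : ∀ K : Finset (T × ℝ),
      ((μ₁.map fun ω t => f₁ t ω).restrict {x | a ≤ x t}) (lowerBox K) =
      ((μ₂.map fun ω t => f₂ t ω).restrict {x | a ≤ x t}) (lowerBox K) := fun K => by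
    have hm := (measurableSet_lowerBox K).inter hS
    rw [Measure.restrict_apply (measurableSet_lowerBox K),
      Measure.restrict_apply (measurableSet_lowerBox K),
      Measure.map_apply (measurable_coordinates h₁.1) hm,
      Measure.map_apply (measurable_coordinates h₂.1) hm, Set.preimage_inter, Set.preimage_inter,
      Set.preimage_ofPred_eq, Set.preimage_ofPred_eq]
    by_cases hK : ∀ k ∈ K, 0 < k.2
    · have hK' : ∀ k ∈ insert (t, a) K, 0 < k.2 := Finset.forall_mem_insert _ _ _ |>.2 ⟨ha, hK⟩
      rw [measure_preimage_lowerBox_inter h₁.1 hK, measure_preimage_lowerBox_inter h₂.1 hK,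
        h₁.measure_exceedance_eq h₂ hK, h₁.measure_exceedance_eq h₂ hK']
    · push Not at hK
      obtain ⟨k, hk, hk0⟩ := hK
      rw [measure_inter_null_of_null_left _ (measure_preimage_lowerBox_eq_zero h₁.1 hk hk0),
        measure_inter_null_of_null_left _ (measure_preimage_lowerBox_eq_zero h₂.1 hk hk0)]
  have : IsFiniteMeasure ((μ₁.map fun ω t => f₁ t ω).restrict {x | a ≤ x t}) := by
    refine ⟨?_⟩
    rw [Measure.restrict_apply_univ, Measure.map_apply (measurable_coordinates h₁.1) hS]
    exact (h₁.1 t).measure_le_lt_top ha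
  have huniv : lowerBox (∅ : Finset (T × ℝ)) = Set.univ := by ext; simp [lowerBox]
  refine ext_of_generate_finite _ pi_eq_generateFrom_range_lowerBox isPiSystem_range_lowerBox ?_
    (huniv ▸ hbox ∅)
  rintro _ ⟨K, rfl⟩
  exact hbox K

/-- The exponent measure is determined by the process. -/
theorem IsMinimalSpectralRepresentation.map_eq [SigmaFinite μ₁] [SigmaFinite μ₂]
    (h₁ : IsMinimalSpectralRepresentation X P f₁ μ₁)
    (h₂ : IsMinimalSpectralRepresentation X P f₂ μ₂) :
    (μ₁.map fun ω t => f₁ t ω) = μ₂.map fun ω t => f₂ t ω := by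
  obtain ⟨D₁, hD₁, hp₁⟩ := h₁.2.exists_countable_ae_pos h₁.1.1
  obtain ⟨D₂, hD₂, hp₂⟩ := h₂.2.exists_countable_ae_pos h₂.1.1
  have : Countable ↥(D₁ ∪ D₂) := (hD₁.union hD₂).to_subtype
  let s : ↥(D₁ ∪ D₂) × ℕ → Set (T → ℝ) := fun p => {x | 1 / ((p.2 : ℝ) + 1) ≤ x p.1}
  have hs : ∀ p, MeasurableSet (s p) := fun p =>
    measurableSet_le measurable_const (measurable_pi_apply _)
  have hcover : ∀ {x : T → ℝ}, (∃ t ∈ D₁ ∪ D₂, 0 < x t) → x ∈ ⋃ p, s p := by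
    rintro x ⟨t, ht, hx⟩
    obtain ⟨n, hn⟩ := exists_nat_one_div_lt hx
    exact Set.mem_iUnion.2 ⟨(⟨t, ht⟩, n), hn.le⟩
  have hU : MeasurableSet (⋃ p, s p) := MeasurableSet.iUnion hs
  have hae₁ : ∀ᵐ x ∂μ₁.map fun ω t => f₁ t ω, x ∈ ⋃ p, s p := by
    refine (ae_map_iff (measurable_coordinates h₁.1.1).aemeasurable hU).2 ?_
    filter_upwards [hp₁] with ω hω
    obtain ⟨t, ht, hlt⟩ := hω
    exact hcover ⟨t, Or.inl ht, hlt⟩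
  have hae₂ : ∀ᵐ x ∂μ₂.map fun ω t => f₂ t ω, x ∈ ⋃ p, s p := by
    refine (ae_map_iff (measurable_coordinates h₂.1.1).aemeasurable hU).2 ?_
    filter_upwards [hp₂] with ω hω
    obtain ⟨t, ht, hlt⟩ := hω
    exact hcover ⟨t, Or.inr ht, hlt⟩
  rw [← Measure.restrict_eq_self_of_ae_mem hae₁, ← Measure.restrict_eq_self_of_ae_mem hae₂,
    Measure.restrict_iUnion_congr]
  exact fun p => h₁.1.restrict_map_eq h₂.1 _ Nat.one_div_pos_of_nat

/-- Up to null sets, every measurable set is the preimage of a measurable set of the product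
space under a minimal family. -/
theorem IsMinimalFamily.exists_ae_mem_iff (h : IsMinimalFamily f₁ μ₁) {B : Set Ω₁}
    (hB : MeasurableSet B) :
    ∃ C : Set (T → ℝ), MeasurableSet C ∧ ∀ᵐ ω ∂μ₁, (fun t => f₁ t ω) ∈ C ↔ ω ∈ B := by
  obtain ⟨A, hA, hAB⟩ := h.generates B hB
  obtain ⟨C, hC, rfl⟩ := exists_preimage_of_measurableSet_iSup_comap hA
  exact ⟨C, hC, Filter.eventuallyEq_set.1 (measure_symmDiff_eq_zero_iff.1 hAB)⟩

/-- A minimal family on a standard Borel space has a measurable left inverse almost everywhere. -/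
theorem IsMinimalFamily.exists_measurable_leftInverse [StandardBorelSpace Ω₁] [Nonempty Ω₁]
    (h : IsMinimalFamily f₁ μ₁) :
    ∃ r : (T → ℝ) → Ω₁, Measurable r ∧ ∀ᵐ ω ∂μ₁, r (fun t => f₁ t ω) = ω := by
  classical
  have hemb : MeasurableEmbedding (MeasurableSpace.mapNatBool Ω₁) :=
    (MeasurableSpace.measurable_mapNatBool Ω₁).measurableEmbedding
      (MeasurableSpace.injective_mapNatBool Ω₁)
  obtain ⟨g, hg, hgr⟩ := hemb.exists_measurable_extend measurable_id fun _ => ‹_›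
  choose C hC hCae using fun n => h.exists_ae_mem_iff
    (MeasurableSpace.measurableSet_natGeneratingSequence (α := Ω₁) n)
  refine ⟨fun x => g fun n => decide (x ∈ C n), hg.comp (measurable_pi_iff.2 fun n =>
    measurable_to_bool ?_), ?_⟩
  · have : (fun x => decide (x ∈ C n)) ⁻¹' {true} = C n := by ext; simp
    rw [this]
    exact hC n
  · filter_upwards [ae_all_iff.2 hCae] with ω hω
    have : (fun n => decide ((fun t => f₁ t ω) ∈ C n)) = MeasurableSpace.mapNatBool Ω₁ ω := by
      ext n
      simp [MeasurableSpace.mapNatBool, hω n]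
    rw [this]
    exact congr_fun hgr ω

theorem IsMinimalSpectralRepresentation.exists_measurePreserving [SigmaFinite μ₁] [SigmaFinite μ₂]
    [StandardBorelSpace Ω₁] [Nonempty Ω₁] (h₁ : IsMinimalSpectralRepresentation X P f₁ μ₁)
    (h₂ : IsMinimalSpectralRepresentation X P f₂ μ₂) :
    ∃ Φ : Ω₂ → Ω₁, MeasurePreserving Φ μ₂ μ₁ ∧ ∀ t, ∀ᵐ ω ∂μ₂, f₂ t ω = f₁ t (Φ ω) := by
  obtain ⟨r, hr, hrae⟩ := h₁.2.exists_measurable_leftInverse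
  have hm₁ := measurable_coordinates h₁.1.1
  have hm₂ := measurable_coordinates h₂.1.1
  refine ⟨fun ω => r fun t => f₂ t ω, ⟨hr.comp hm₂, ?_⟩, fun t => ?_⟩
  · have h : (r ∘ fun ω t => f₁ t ω) =ᵐ[μ₁] id := hrae
    change μ₂.map (r ∘ fun ω t => f₂ t ω) = μ₁
    rw [← Measure.map_map hr hm₂, ← h₁.map_eq h₂, Measure.map_map hr hm₁, Measure.map_congr h,
      Measure.map_id]
  · have hmeas : MeasurableSet {x : T → ℝ | x t = f₁ t (r x)} :=
      measurableSet_eq_fun (measurable_pi_apply t) ((h₁.1.1 t).measurable.comp hr)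
    refine (ae_map_iff hm₂.aemeasurable hmeas).1 ?_
    rw [← h₁.map_eq h₂, ae_map_iff hm₁.aemeasurable hmeas]
    filter_upwards [hrae] with ω hω
    rw [hω]

/-- Measure preserving maps into a standard Borel space that intertwine a family of functions with
a minimal family are unique almost everywhere. -/
theorem IsMinimalFamily.ae_eq_of_measurePreserving [StandardBorelSpace Ω₁]
    (h : IsMinimalFamily f₁ μ₁) {Φ Ψ : Ω₂ → Ω₁}
    (hΦ : MeasurePreserving Φ μ₂ μ₁) (hΦf : ∀ t, ∀ᵐ ω ∂μ₂, f₂ t ω = f₁ t (Φ ω))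
    (hΨ : MeasurePreserving Ψ μ₂ μ₁) (hΨf : ∀ t, ∀ᵐ ω ∂μ₂, f₂ t ω = f₁ t (Ψ ω)) :
    ∀ᵐ ω ∂μ₂, Ψ ω = Φ ω := by
  have key : ∀ n, ∀ᵐ ω ∂μ₂, Ψ ω ∈ MeasurableSpace.natGeneratingSequence Ω₁ n ↔
      Φ ω ∈ MeasurableSpace.natGeneratingSequence Ω₁ n := fun n => by
    obtain ⟨C, hC, hCae⟩ :=
      h.exists_ae_mem_iff (MeasurableSpace.measurableSet_natGeneratingSequence (α := Ω₁) n)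
    filter_upwards [hΦ.quasiMeasurePreserving.ae hCae, hΨ.quasiMeasurePreserving.ae hCae,
      ae_mem_iff_of_forall_ae_eq (F := fun ω t => f₂ t ω) hΦf hC,
      ae_mem_iff_of_forall_ae_eq (F := fun ω t => f₂ t ω) hΨf hC] with ω h₁ h₂ h₃ h₄
    rw [← h₁, ← h₂, ← h₃, ← h₄]
  filter_upwards [ae_all_iff.2 key] with ω hω
  refine MeasurableSpace.injective_mapNatBool Ω₁ (funext fun n => ?_)
  simp [MeasurableSpace.mapNatBool, hω n]

/-- Measure preserving maps that are inverse to each other almost everywhere are isomorphisms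
modulo null sets. -/
theorem MeasureTheory.MeasurePreserving.isMeasureSpaceIso [StandardBorelSpace Ω₁]
    [StandardBorelSpace Ω₂] {Φ : Ω₂ → Ω₁} {Ψ : Ω₁ → Ω₂} (hΦ : MeasurePreserving Φ μ₂ μ₁)
    (hΨ : MeasurePreserving Ψ μ₁ μ₂) (hΨΦ : ∀ᵐ ω ∂μ₂, Ψ (Φ ω) = ω)
    (hΦΨ : ∀ᵐ ω ∂μ₁, Φ (Ψ ω) = ω) : IsMeasureSpaceIso Φ μ₂ μ₁ := by
  have hm₂ : MeasurableSet {ω | Ψ (Φ ω) = ω} :=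
    measurableSet_eq_fun (hΨ.measurable.comp hΦ.measurable) measurable_id
  have hm₁ : MeasurableSet {ω | Φ (Ψ ω) = ω} :=
    measurableSet_eq_fun (hΦ.measurable.comp hΨ.measurable) measurable_id
  let e : ({ω | Ψ (Φ ω) = ω}ᶜᶜ : Set Ω₂) ≃ᵐ ({ω | Φ (Ψ ω) = ω}ᶜᶜ : Set Ω₁) :=
    { toFun := fun ω => ⟨Φ ω, not_not.2 (congrArg Φ (not_not.1 ω.2))⟩
      invFun := fun ω => ⟨Ψ ω, not_not.2 (congrArg Ψ (not_not.1 ω.2))⟩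
      left_inv := fun ω => Subtype.ext (not_not.1 ω.2)
      right_inv := fun ω => Subtype.ext (not_not.1 ω.2)
      measurable_toFun := (hΦ.measurable.comp measurable_subtype_coe).subtype_mk
      measurable_invFun := (hΨ.measurable.comp measurable_subtype_coe).subtype_mk }
  refine ⟨{ω | Ψ (Φ ω) = ω}ᶜ, {ω | Φ (Ψ ω) = ω}ᶜ, hm₂.compl, hm₁.compl, hΨΦ, hΦΨ, e,
    fun _ => rfl, fun B hB hsub => ?_⟩
  rw [← hΨ.measure_preimage hB.nullMeasurableSet]
  refine measure_congr (Filter.eventuallyEq_set.2 ?_)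
  filter_upwards [hΦΨ] with ω hω
  constructor
  · exact fun h => ⟨Ψ ω, h, hω⟩
  · rintro ⟨ω', hω', rfl⟩
    have : Ψ (Φ ω') = ω' := not_not.1 (hsub hω')
    rwa [Set.mem_preimage, this]

theorem IsMinimalSpectralRepresentation.isMeasureSpaceIso [SigmaFinite μ₁] [SigmaFinite μ₂]
    [StandardBorelSpace Ω₁] [StandardBorelSpace Ω₂]
    (h₁ : IsMinimalSpectralRepresentation X P f₁ μ₁)
    (h₂ : IsMinimalSpectralRepresentation X P f₂ μ₂) {Φ : Ω₂ → Ω₁}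
    (hΦ : MeasurePreserving Φ μ₂ μ₁) (hΦf : ∀ t, ∀ᵐ ω ∂μ₂, f₂ t ω = f₁ t (Φ ω)) :
    IsMeasureSpaceIso Φ μ₂ μ₁ := by
  cases isEmpty_or_nonempty Ω₂ with
  | inl _ =>
    have hμ₁ : μ₁ = 0 := by
      rw [← hΦ.map_eq, μ₂.eq_zero_of_isEmpty, Measure.map_zero]
    have : IsEmpty (Set.univᶜ : Set Ω₁) := ⟨fun ω => ω.2 trivial⟩
    have : IsEmpty (Set.univᶜ : Set Ω₂) := ⟨fun ω => ω.2 trivial⟩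
    refine ⟨Set.univ, Set.univ, .univ, .univ, ?_, ?_, ⟨.equivOfIsEmpty _ _, measurable_of_empty _,
      measurable_of_empty _⟩,
      fun ω => isEmptyElim ω, fun B _ _ => ?_⟩
    · simp [μ₂.eq_zero_of_isEmpty]
    · simp [hμ₁]
    · simp [hμ₁, μ₂.eq_zero_of_isEmpty]
  | inr _ =>
    obtain ⟨Ψ, hΨ, hΨf⟩ := h₂.exists_measurePreserving h₁
    refine hΦ.isMeasureSpaceIso hΨ ?_ ?_
    · refine h₂.2.ae_eq_of_measurePreserving (f₂ := f₂) (Φ := id) (.id _) (fun _ => .of_forall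
        fun _ => rfl) (Ψ := Ψ ∘ Φ) (hΨ.comp hΦ) fun t => ?_
      filter_upwards [hΦf t, hΦ.quasiMeasurePreserving.ae (hΨf t)] with ω h h'
      exact h.trans h'
    · refine h₁.2.ae_eq_of_measurePreserving (f₂ := f₁) (Φ := id) (.id _) (fun _ => .of_forall
        fun _ => rfl) (Ψ := Φ ∘ Ψ) (hΦ.comp hΨ) fun t => ?_
      filter_upwards [hΨf t, hΨ.quasiMeasurePreserving.ae (hΦf t)] with ω h h'
      exact h.trans h'

end Isomorphism

theorem mainTheorem1 {T : Type u} {E : Type v} [MeasurableSpace E] (P : Measure E)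
    [IsProbabilityMeasure P] (X : T → E → ℝ) (hXmeas : ∀ t, Measurable (X t))
    (hXmax : IsMaxID X P) (hXinf : ∀ t, essInf (fun e => (X t e : EReal)) P = 0)
    {Ω₁ Ω₂ : Type*} [MeasurableSpace Ω₁] [MeasurableSpace Ω₂] [Nonempty Ω₁]
    (μ₁ : Measure Ω₁) (μ₂ : Measure Ω₂) [SigmaFinite μ₁] [SigmaFinite μ₂]
    (f₁ : T → Ω₁ → ℝ) (f₂ : T → Ω₂ → ℝ)
    (h₁ : IsMinimalSpectralRepresentation X P f₁ μ₁)
    (h₂ : IsMinimalSpectralRepresentation X P f₂ μ₂)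
    (hΩ₁ : StandardBorelSpace Ω₁) :
    (∃ Φ : Ω₂ → Ω₁, Measurable Φ ∧ μ₁ = μ₂.map Φ ∧
      ∀ t, ∀ᵐ ω ∂μ₂, f₂ t ω = f₁ t (Φ ω)) ∧
    (StandardBorelSpace Ω₂ →
      ∀ Φ : Ω₂ → Ω₁, Measurable Φ → μ₁ = μ₂.map Φ →
        (∀ t, ∀ᵐ ω ∂μ₂, f₂ t ω = f₁ t (Φ ω)) →
        IsMeasureSpaceIso Φ μ₂ μ₁ ∧
        ∀ Ψ : Ω₂ → Ω₁, AEMeasurable Ψ μ₂ → μ₁ = μ₂.map Ψ →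
          (∀ t, ∀ᵐ ω ∂μ₂, f₂ t ω = f₁ t (Ψ ω)) → ∀ᵐ ω ∂μ₂, Ψ ω = Φ ω) := by
  refine ⟨?_, fun _ Φ hΦm hΦμ hΦf => ⟨?_, fun Ψ hΨm hΨμ hΨf => ?_⟩⟩
  · obtain ⟨Φ, hΦ, hΦf⟩ := h₁.exists_measurePreserving h₂
    exact ⟨Φ, hΦ.measurable, hΦ.map_eq.symm, hΦf⟩
  · exact h₁.isMeasureSpaceIso h₂ ⟨hΦm, hΦμ.symm⟩ hΦf
  · have hmk : MeasurePreserving (hΨm.mk Ψ) μ₂ μ₁ :=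
      ⟨hΨm.measurable_mk, (Measure.map_congr hΨm.ae_eq_mk).symm.trans hΨμ.symm⟩
    have hmkf : ∀ t, ∀ᵐ ω ∂μ₂, f₂ t ω = f₁ t (hΨm.mk Ψ ω) := fun t => by
      filter_upwards [hΨf t, hΨm.ae_eq_mk] with ω h h'
      rw [h, h']
    filter_upwards [hΨm.ae_eq_mk,
      h₁.2.ae_eq_of_measurePreserving ⟨hΦm, hΦμ.symm⟩ hΦf hmk hmkf] with ω h h'
    exact h.trans h'
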